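/- Multigraphs are loopless and may have parallel edges. Let $M$ be a multigraph with more than one vertex whose edges are coloured with two colours, and suppose that $M$ is M-closed: whenever $xyz$ is a path in $M$ whose two edges $xy$ and $yz$ have the same colour, $x$ and $z$ are adjacent. Let $G$ be an extension of $M$, that is, a 2-edge-coloured multigraph obtained from $M$ by replacing every vertex $v$ by a nonempty independent set $I_v$ such that, for $u\neq v$, $x\in I_u$, $y\in I_v$ and each colour $c$, the vertices $x,y$ are joined by an edge of colour $c$ in $G$ if and only if $u,v$ are joined by an edge of colour $c$ in $M$. Suppose that (a) $G$ is colour-connected: for any two distinct vertices $u,v$ of $G$ there are two paths from $u$ to $v$, each with colours alternating along it, whose union (the first path followed by the reverse of the second) is an alternating closed walk; and (b) $G$ has an eulerian factor: there are pairwise vertex-disjoint induced subgraphs $G_1,\dots,G_k$ of $G$ with $V(G)=V(G_1)\cup\dots\cup V(G_k)$, each of which is supereulerian. Then $G$ is supereulerian. Here a 2-edge-coloured multigraph is supereulerian if it contains a spanning alternating closed trail, that is, a closed walk with at least one edge that uses no edge more than once, visits every vertex, and has alternating colours, its last and first edge also having different colours. -/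

import Mathlib

/-! A 2-edge-coloured multigraph is a multigraph `G : Graph α β` (parallel edges allowed) together
with a colouring `φ : β → Fin 2` of its edges; only the values of `φ` on `E(G)` matter. -/

namespace TwoEdgeColoured

open scoped Graph

variable {α β γ δ : Type*}

/-- `IsWalk G u p v`: starting at the vertex `u` and following the steps `p` (each step consists of
the edge that is used and the vertex that is reached) one walks in `G` from `u` to `v`. -/
def IsWalk (G : Graph α β) : α → List (β × α) → α → Prop
  | u, [], v => u ∈ V(G) ∧ u = v
  | u, s :: p, v => G.IsLink s.1 u s.2 ∧ IsWalk G s.2 p v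

/-- The sequence of colours of the edges of a walk. -/
def colours (φ : β → Fin 2) (p : List (β × α)) : List (Fin 2) :=
  p.map fun s => φ s.1

/-- Consecutive entries are different. -/
def Alternates (l : List (Fin 2)) : Prop :=
  l.IsChain (· ≠ ·)

/-- Consecutive entries are different, and so are the last and the first one. -/
def AlternatesCyclically (l : List (Fin 2)) : Prop :=
  Alternates l ∧ l.getLast? ≠ l.head?

/-- `p` is an alternating `(u, v)`-path: an alternating walk without repeated vertices. -/
def IsAltPath (G : Graph α β) (φ : β → Fin 2) (u : α) (p : List (β × α)) (v : α) : Prop :=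
  IsWalk G u p v ∧ (u :: p.map Prod.snd).Nodup ∧ Alternates (colours φ p)

/-- `p` is an alternating closed trail through `u`: a closed walk with at least one edge and without
repeated edges, whose colours alternate, also between its last and its first edge. -/
def IsAltClosedTrail (G : Graph α β) (φ : β → Fin 2) (u : α) (p : List (β × α)) : Prop :=
  p ≠ [] ∧ IsWalk G u p u ∧ (p.map Prod.fst).Nodup ∧ AlternatesCyclically (colours φ p)

/-- Any two distinct vertices `u, v` are joined by two alternating `(u, v)`-paths whose union (the
first one followed by the reverse of the second one) is an alternating closed walk. -/
def ColourConnected (G : Graph α β) (φ : β → Fin 2) : Prop :=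
  ∀ u ∈ V(G), ∀ v ∈ V(G), u ≠ v → ∃ p q : List (β × α),
    IsAltPath G φ u p v ∧ IsAltPath G φ u q v ∧
      AlternatesCyclically (colours φ p ++ (colours φ q).reverse)

/-- The graph has a spanning alternating closed trail. -/
def Supereulerian (G : Graph α β) (φ : β → Fin 2) : Prop :=
  ∃ (u : α) (p : List (β × α)), IsAltClosedTrail G φ u p ∧ ∀ v ∈ V(G), v ∈ p.map Prod.snd

/-- Vertex-disjoint induced subgraphs that cover all vertices, each of them supereulerian. -/
def HasEulerianFactor (G : Graph α β) (φ : β → Fin 2) : Prop :=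
  ∃ (k : ℕ) (S : Fin k → Set α),
    (∀ i j, i ≠ j → Disjoint (S i) (S j)) ∧ (⋃ i, S i) = V(G) ∧
      ∀ i, Supereulerian (G.induce (S i)) φ

/-- The ends of every monochromatic path of length two are adjacent. -/
def MClosed (G : Graph α β) (φ : β → Fin 2) : Prop :=
  ∀ (x y z : α) (e f : β), x ≠ y → y ≠ z → x ≠ z →
    G.IsLink e x y → G.IsLink f y z → φ e = φ f → G.Adj x z

/-- `(G, φ)` is an extension of `(M, ψ)`: here `M` has more than one vertex, each vertex `a` of `M`
is replaced by a nonempty independent set `{x ∈ V(G) | π x = a}`, and two vertices in different such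
sets are joined by an edge of colour `c` exactly when the vertices that they replace are. The number
of parallel edges of the same colour is not prescribed. -/
def IsExtension (M : Graph γ δ) (ψ : δ → Fin 2) (G : Graph α β) (φ : β → Fin 2) : Prop :=
  V(M).Nontrivial ∧ ∃ π : α → γ,
    π '' V(G) = V(M) ∧
    (∀ x ∈ V(G), ∀ y ∈ V(G), π x = π y → ¬ G.Adj x y) ∧
    ∀ x ∈ V(G), ∀ y ∈ V(G), π x ≠ π y → ∀ c : Fin 2,
      (∃ e, G.IsLink e x y ∧ φ e = c) ↔ ∃ f, M.IsLink f (π x) (π y) ∧ ψ f = c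

end TwoEdgeColoured

namespace TwoEdgeColoured

open scoped Graph

variable {α β γ δ : Type*}

/-! ### Alternating walks -/

/-! Partition `V(G)` into as few vertex sets of alternating closed trails ("tours") as possible, and
suppose that there are at least two members. Minimality forbids covering two or three members by one
tour, which excludes many edge configurations, whereas M-closedness keeps forcing edges; the proof
plays these against each other.

Let `S`, `T` be two members. By `IsTour.switch` they contain no twins, so every monochromatic path
of length two from `S` to `T` has adjacent ends. If there are edges between them, some vertex sends
edges of only one colour to the other member (`exists_mono`), then some vertex is joined in one
colour to all of it (`exists_full`), and this property spreads around its tour, the colour flipping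
at each edge. So of two adjacent members one dominates the other. Domination is asymmetric and has
no cyclic triangles; with connectedness this yields a member `R` that dominates all others
(`exists_dominating`).

By `exists_isTour_of_full_of_full`, all edges that leave `R` at a vertex `x` have one colour, the
label of `x`. An alternating walk that starts in `R` with the colour other than the label cannot
leave `R`: by `full_ne_of_isLink` the colour due next always differs from the label of the current
vertex. Colour-connectedness supplies such a walk ending outside `R`, a contradiction. -/

lemma one_sub_ne (c : Fin 2) : 1 - c ≠ c := by revert c; decide

lemma one_sub_one_sub (c : Fin 2) : 1 - (1 - c) = c := by revert c; decide

lemma eq_one_sub_of_ne {c d : Fin 2} (h : d ≠ c) : d = 1 - c := by revert c d; decide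

/-- `AltWalk G φ u c p v d`: the steps `p` form an alternating walk from `u` to `v` whose first edge
has colour `c`, and which can be continued at `v` by an edge of colour `d`. -/
def AltWalk (G : Graph α β) (φ : β → Fin 2) : α → Fin 2 → List (β × α) → α → Fin 2 → Prop
  | u, c, [], v, d => u = v ∧ c = d
  | u, c, s :: p, v, d => G.IsLink s.1 u s.2 ∧ φ s.1 = c ∧ AltWalk G φ s.2 (1 - c) p v d

variable {G : Graph α β} {φ : β → Fin 2}

lemma altWalk_append {p q : List (β × α)} {u w : α} {c d : Fin 2} :
    AltWalk G φ u c (p ++ q) w d ↔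
      ∃ v b, AltWalk G φ u c p v b ∧ AltWalk G φ v b q w d := by
  induction p generalizing u c with
  | nil =>
    constructor
    · exact fun h => ⟨u, c, ⟨rfl, rfl⟩, h⟩
    · rintro ⟨v, b, ⟨rfl, rfl⟩, h⟩
      exact h
  | cons s p ih =>
    constructor
    · rintro ⟨hl, hc, h⟩
      obtain ⟨v, b, h₁, h₂⟩ := ih.1 h
      exact ⟨v, b, ⟨hl, hc, h₁⟩, h₂⟩
    · rintro ⟨v, b, ⟨hl, hc, h₁⟩, h₂⟩
      exact ⟨hl, hc, ih.2 ⟨v, b, h₁, h₂⟩⟩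

lemma AltWalk.exists_reverse {p : List (β × α)} {u v : α} {c d : Fin 2}
    (h : AltWalk G φ u c p v d) :
    ∃ q, AltWalk G φ v (1 - d) q u (1 - c) ∧ q.map Prod.fst = (p.map Prod.fst).reverse ∧
      ∀ x, x ∈ v :: q.map Prod.snd ↔ x ∈ u :: p.map Prod.snd := by
  induction p generalizing u c with
  | nil =>
    obtain ⟨rfl, rfl⟩ := h
    exact ⟨[], ⟨rfl, rfl⟩, by simp, by simp⟩
  | cons s p ih =>
    obtain ⟨hl, hc, h⟩ := h
    obtain ⟨q, hq, he, hv⟩ := ih h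
    refine ⟨q ++ [(s.1, u)], ?_, by simp [he], ?_⟩
    · rw [one_sub_one_sub] at hq
      exact altWalk_append.2 ⟨_, _, hq, hl.symm, hc, rfl, rfl⟩
    · intro x
      have := hv x
      simp only [List.map_append, List.mem_cons, List.mem_append, List.map_cons, List.map_nil,
        List.not_mem_nil, or_false] at this ⊢
      tauto

lemma AltWalk.end_mem {p : List (β × α)} {u v : α} {c d : Fin 2}
    (h : AltWalk G φ u c p v d) : v ∈ u :: p.map Prod.snd := by
  induction p generalizing u c with
  | nil => simp [h.1]
  | cons s p ih => exact List.mem_cons_of_mem _ (by simpa using ih h.2.2)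

lemma AltWalk.isWalk {p : List (β × α)} {u v : α} {c d : Fin 2}
    (h : AltWalk G φ u c p v d) (hp : p ≠ []) : IsWalk G u p v := by
  induction p generalizing u c with
  | nil => exact absurd rfl hp
  | cons s p ih =>
    refine ⟨h.1, ?_⟩
    cases p with
    | nil => exact ⟨h.1.right_mem, h.2.2.1⟩
    | cons t p => exact ih h.2.2 (by simp)

lemma AltWalk.alternates {p : List (β × α)} {u v : α} {c d : Fin 2}
    (h : AltWalk G φ u c p v d) :
    Alternates (colours φ p) ∧ (∀ a ∈ (colours φ p).head?, a = c) ∧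
      (∀ a ∈ (colours φ p).getLast?, a = 1 - d) := by
  induction p generalizing u c with
  | nil => simp [colours, Alternates]
  | cons s p ih =>
    obtain ⟨hl, hc, h⟩ := h
    obtain ⟨h1, h2, h3⟩ := ih h
    refine ⟨?_, ?_, ?_⟩
    · simp only [colours, Alternates, List.map_cons, List.isChain_cons] at h1 h2 ⊢
      refine ⟨?_, h1⟩
      intro y hy
      rw [h2 y hy, hc]
      exact (one_sub_ne c).symm
    · intro a ha
      simp [colours] at ha
      rw [← ha, hc]
    · intro a ha
      cases p with
      | nil =>
        simp [colours] at ha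
        rw [← ha, hc, ← h.2, one_sub_one_sub]
      | cons t p =>
        apply h3
        simpa [colours] using ha

lemma exists_altWalk_of_isWalk {p : List (β × α)} {u v : α} {c : Fin 2}
    (h : IsWalk G u p v) (ha : Alternates (colours φ p)) (hc : ∀ a ∈ (colours φ p).head?, a = c) :
    ∃ d, AltWalk G φ u c p v d := by
  induction p generalizing u c with
  | nil => exact ⟨c, h.2, rfl⟩
  | cons s p ih =>
    obtain ⟨hl, h⟩ := h
    have hs : φ s.1 = c := hc _ (by simp [colours])
    simp only [colours, Alternates, List.map_cons, List.isChain_cons] at ha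
    obtain ⟨d, hd⟩ := ih (c := 1 - c) h ha.2 (fun a h' => by
      have := ha.1 a h'
      rw [hs] at this
      exact eq_one_sub_of_ne this.symm)
    exact ⟨d, hl, hs, hd⟩

/-- The state of a walk is its current vertex together with the colour due next; `P` is a property
of states that every step preserves. -/
lemma AltWalk.propagate {p : List (β × α)} {u v : α} {c d : Fin 2} {e : β}
    (h : AltWalk G φ u c p v d) {P : α → Fin 2 → Prop}
    (hP : ∀ e ∈ p.map Prod.fst, ∀ x y, G.IsLink e x y → P x (φ e) → P y (1 - φ e))
    (hu : P u c) (he : e ∈ p.map Prod.fst) :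
    ∃ y z, G.IsLink e y z ∧ P y (φ e) ∧ P z (1 - φ e) := by
  induction p generalizing u c with
  | nil => simp at he
  | cons s p ih =>
    obtain ⟨hl, rfl, hw⟩ := h
    have hs := hP s.1 (by simp) _ _ hl hu
    rw [List.map_cons, List.mem_cons] at he
    rcases he with rfl | he
    · exact ⟨u, s.2, hl, hu, hs⟩
    · exact ih hw (fun g hg => hP g (List.mem_cons_of_mem _ hg)) hs he

/-! ### Tours -/

/-- `S` is the vertex set and `E` the edge set of an alternating closed trail of `G`. -/
def IsTour (G : Graph α β) (φ : β → Fin 2) (S : Set α) (E : Set β) : Prop :=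
  ∃ u c p, p ≠ [] ∧ AltWalk G φ u c p u c ∧ (p.map Prod.fst).Nodup ∧
    (∀ v, v ∈ S ↔ v ∈ p.map Prod.snd) ∧ ∀ e, e ∈ E ↔ e ∈ p.map Prod.fst

variable {S T U W : Set α} {E F Q : Set β} {x y z : α} {c d : Fin 2} {e : β}

lemma IsTour.supereulerian (h : IsTour G φ V(G) E) : Supereulerian G φ := by
  obtain ⟨u, c, p, hp, hw, hn, hS, hE⟩ := h
  obtain ⟨h1, h2, h3⟩ := hw.alternates
  refine ⟨u, p, ⟨hp, hw.isWalk hp, hn, h1, fun h => ?_⟩, fun v => (hS v).1⟩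
  have hne : colours φ p ≠ [] := by simpa [colours] using hp
  have ha := h2 _ (List.head?_eq_some_head hne)
  have hb := h3 _ (List.getLast?_eq_some_getLast hne)
  rw [List.head?_eq_some_head hne, List.getLast?_eq_some_getLast hne] at h
  have := Option.some.inj h
  rw [ha, hb] at this
  exact one_sub_ne c this

lemma isWalk_induce {p : List (β × α)} {u v : α} (h : IsWalk (G.induce S) u p v) (hp : p ≠ []) :
    IsWalk G u p v ∧ ∀ x ∈ p.map Prod.snd, x ∈ S := by
  induction p generalizing u with
  | nil => exact absurd rfl hp
  | cons s p ih =>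
    obtain ⟨hl, h⟩ := h
    rw [Graph.induce_isLink] at hl
    cases p with
    | nil => exact ⟨⟨hl.1, hl.1.right_mem, h.2⟩, by simpa using hl.2.2⟩
    | cons t p =>
      obtain ⟨h1, h2⟩ := ih h (by simp)
      refine ⟨⟨hl.1, h1⟩, ?_⟩
      intro x hx
      rw [List.map_cons, List.mem_cons] at hx
      rcases hx with rfl | hx
      · exact hl.2.2
      · exact h2 x hx

lemma exists_isTour_of_supereulerian (h : Supereulerian (G.induce S) φ) :
    ∃ E, IsTour G φ S E := by
  obtain ⟨u, p, ⟨hp, hw, hn, ha, hl⟩, hS⟩ := h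
  obtain ⟨hw', hm⟩ := isWalk_induce hw hp
  have hne : colours φ p ≠ [] := by simpa [colours] using hp
  obtain ⟨d, hd⟩ := exists_altWalk_of_isWalk (c := (colours φ p).head hne) hw' ha
    (fun a h => by rw [List.head?_eq_some_head hne] at h; exact (Option.some.inj h).symm)
  refine ⟨{e | e ∈ p.map Prod.fst}, u, (colours φ p).head hne, p, hp, ?_, hn,
    fun v => ⟨hS v, hm v⟩, fun e => Iff.rfl⟩
  have hb := hd.alternates.2.2 _ (List.getLast?_eq_some_getLast hne)
  rw [List.head?_eq_some_head hne, List.getLast?_eq_some_getLast hne] at hl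
  have hcd : d = (colours φ p).head hne := by
    have h1 : (colours φ p).getLast hne ≠ (colours φ p).head hne := fun h => hl (by rw [h])
    rw [hb] at h1
    have := eq_one_sub_of_ne h1.symm
    rw [one_sub_one_sub] at this
    exact this.symm
  rw [hcd] at hd
  exact hd

/-- A tour, opened at one of its edges, traversed in a prescribed direction. -/
lemma IsTour.exists_open (h : IsTour G φ S E) (he : e ∈ E) (hl : G.IsLink e x y) :
    ∃ p, AltWalk G φ y (1 - φ e) p x (φ e) ∧ (e :: p.map Prod.fst).Nodup ∧
      (∀ v, v ∈ S ↔ v ∈ y :: p.map Prod.snd) ∧ ∀ f, f ∈ E ↔ f ∈ e :: p.map Prod.fst := by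
  obtain ⟨u, c, p, hp, hw, hn, hS, hE⟩ := h
  obtain ⟨s, hs, rfl⟩ := List.mem_map.1 ((hE e).1 he)
  obtain ⟨p₁, p₂, rfl⟩ := List.append_of_mem hs
  obtain ⟨a, b, h₁, hla, hb, h₂⟩ := altWalk_append.1 hw
  subst hb
  -- Rotate the closed trail so that it starts just after the chosen edge; if that edge was
  -- traversed from `y` to `x`, the rest is reversed below.
  have hq : AltWalk G φ s.2 (1 - φ s.1) (p₂ ++ p₁) a (φ s.1) := altWalk_append.2 ⟨_, _, h₂, h₁⟩
  have hqn : (s.1 :: (p₂ ++ p₁).map Prod.fst).Nodup := by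
    refine List.Perm.nodup ?_ hn
    rw [List.map_append, List.map_append, List.map_cons]
    exact List.perm_middle.trans (List.Perm.cons _ List.perm_append_comm)
  have hqS : ∀ v, v ∈ S ↔ v ∈ s.2 :: (p₂ ++ p₁).map Prod.snd := by
    intro v
    rw [hS]
    simp only [List.map_append, List.mem_cons, List.mem_append, List.map_cons]
    tauto
  have hqE : ∀ v, v ∈ E ↔ v ∈ s.1 :: (p₂ ++ p₁).map Prod.fst := by
    intro v
    rw [hE]
    simp only [List.map_append, List.mem_cons, List.mem_append, List.map_cons]
    tauto
  rcases hla.eq_and_eq_or_eq_and_eq hl with ⟨rfl, rfl⟩ | ⟨rfl, rfl⟩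
  · exact ⟨_, hq, hqn, hqS, hqE⟩
  · obtain ⟨q, h1, h2, h3⟩ := hq.exists_reverse
    rw [one_sub_one_sub] at h1
    refine ⟨q, h1, ?_, fun v => by rw [hqS, h3], fun f => by
      rw [hqE, h2, List.mem_cons, List.mem_cons, List.mem_reverse]⟩
    rw [h2]
    refine List.Perm.nodup ?_ hqn
    exact List.Perm.cons _ (List.reverse_perm _).symm

/-- A tour enters and leaves each of its vertices by edges of different colours, so both colours are
available there. -/
lemma IsTour.exists_link (h : IsTour G φ S E) (hx : x ∈ S) (c : Fin 2) :
    ∃ e ∈ E, ∃ y, G.IsLink e x y ∧ φ e = c := by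
  obtain ⟨u, b, p, hp, hw, hn, hS, hE⟩ := id h
  obtain ⟨s, hs, rfl⟩ := List.mem_map.1 ((hS x).1 hx)
  have hsE : s.1 ∈ E := (hE _).2 (List.mem_map.2 ⟨s, hs, rfl⟩)
  obtain ⟨p₁, p₂, rfl⟩ := List.append_of_mem hs
  obtain ⟨a, b, h₁, hla, hb, h₂⟩ := altWalk_append.1 hw
  by_cases hc : φ s.1 = c
  · exact ⟨s.1, hsE, a, hla.symm, hc⟩
  · obtain ⟨q, hq, -, -, hqE⟩ := h.exists_open hsE hla
    cases q with
    | nil => exact absurd hq.2 (one_sub_ne _)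
    | cons t q =>
      refine ⟨t.1, (hqE _).2 (by simp), t.2, hq.1, ?_⟩
      rw [hq.2.1]
      exact (eq_one_sub_of_ne (fun h => hc h.symm)).symm

lemma IsTour.right_mem (h : IsTour G φ S E) (he : e ∈ E) (hl : G.IsLink e x y) : y ∈ S := by
  obtain ⟨p, -, -, hS, -⟩ := h.exists_open he hl
  exact (hS y).2 (by simp)

lemma IsTour.left_mem (h : IsTour G φ S E) (he : e ∈ E) (hl : G.IsLink e x y) : x ∈ S :=
  h.right_mem he hl.symm

lemma IsTour.nonempty (h : IsTour G φ S E) : S.Nonempty := by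
  obtain ⟨u, c, p, hp, hw, hn, hS, hE⟩ := h
  cases p with
  | nil => exact absurd rfl hp
  | cons s p => exact ⟨s.2, (hS _).2 (by simp)⟩

lemma IsTour.finite (h : IsTour G φ S E) : S.Finite := by
  obtain ⟨u, c, p, hp, hw, hn, hS, hE⟩ := h
  exact (List.finite_toSet (p.map Prod.snd)).subset fun v hv => (hS v).1 hv

lemma IsTour.subset (h : IsTour G φ S E) : S ⊆ V(G) := by
  intro x hx
  obtain ⟨e, -, y, hl, -⟩ := h.exists_link hx 0
  exact hl.left_mem

lemma IsTour.edge_link (h : IsTour G φ S E) (he : e ∈ E) : ∃ x y, G.IsLink e x y := by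
  obtain ⟨u, c, p, hp, hw, hn, hS, hE⟩ := h
  obtain ⟨s, hs, rfl⟩ := List.mem_map.1 ((hE e).1 he)
  obtain ⟨p₁, p₂, rfl⟩ := List.append_of_mem hs
  obtain ⟨a, b, h₁, hla, hb, h₂⟩ := altWalk_append.1 hw
  exact ⟨_, _, hla⟩

lemma IsTour.disjoint_edges (h : IsTour G φ S E) (h' : IsTour G φ T F) (hST : Disjoint S T) :
    Disjoint E F := by
  rw [Set.disjoint_left]
  intro e he hf
  obtain ⟨x, y, hl⟩ := h.edge_link he
  exact Set.disjoint_left.1 hST (h.left_mem he hl) (h'.left_mem hf hl)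

/-- Two tours without common edges that share a vertex can be combined. -/
lemma IsTour.splice (h : IsTour G φ S E) (h' : IsTour G φ T F) (hEF : Disjoint E F)
    (hx : x ∈ S) (hx' : x ∈ T) : IsTour G φ (S ∪ T) (E ∪ F) := by
  obtain ⟨e, he, y, hl, hc⟩ := h.exists_link hx 0
  obtain ⟨f, hf, z, hl', hc'⟩ := h'.exists_link hx' 0
  obtain ⟨p, hp, hpn, hpS, hpE⟩ := h.exists_open he hl
  obtain ⟨q, hq, hqn, hqS, hqE⟩ := h'.exists_open hf hl'
  rw [hc] at hp
  rw [hc'] at hq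
  refine ⟨x, 0, (e, y) :: p ++ (f, z) :: q, by simp,
    altWalk_append.2 ⟨x, 0, ⟨hl, hc, hp⟩, hl', hc', hq⟩, ?_, ?_, ?_⟩
  · rw [List.map_append]
    refine List.Nodup.append hpn hqn ?_
    intro g hg hg'
    exact Set.disjoint_left.1 hEF ((hpE g).2 hg) ((hqE g).2 hg')
  · intro v
    rw [Set.mem_union, hpS, hqS, List.map_append, List.mem_append]
    rfl
  · intro v
    rw [Set.mem_union, hpE, hqE, List.map_append, List.mem_append]
    rfl

/-- An edge of a tour can be replaced by a walk. -/
lemma IsTour.replace_edge (h : IsTour G φ S E) (he : e ∈ E) (hl : G.IsLink e x y)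
    {q : List (β × α)} (hq : AltWalk G φ x (φ e) q y (1 - φ e)) (hqn : (q.map Prod.fst).Nodup)
    (hqE : ∀ f ∈ q.map Prod.fst, f ∉ E) :
    ∃ F, IsTour G φ (S ∪ {v | v ∈ q.map Prod.snd}) F ∧
      ∀ f ∈ F, f ∈ E ∨ f ∈ q.map Prod.fst := by
  obtain ⟨p, hp, hpn, hpS, hpE⟩ := h.exists_open he hl
  have hq0 : q ≠ [] := by
    rintro rfl
    exact one_sub_ne _ hq.2.symm
  have hy : y ∈ q.map Prod.snd := by
    cases q with
    | nil => exact absurd rfl hq0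
    | cons s q => simpa using AltWalk.end_mem hq.2.2
  refine ⟨{f | f ∈ (q ++ p).map Prod.fst}, ⟨x, φ e, q ++ p, by simp [hq0],
    altWalk_append.2 ⟨_, _, hq, hp⟩, ?_, ?_, fun f => Iff.rfl⟩, ?_⟩
  · rw [List.map_append]
    refine List.Nodup.append hqn (List.nodup_cons.1 hpn).2 ?_
    intro g hg hg'
    exact hqE g hg ((hpE g).2 (List.mem_cons_of_mem _ hg'))
  · intro v
    rw [Set.mem_union, hpS, List.map_append, List.mem_append, List.mem_cons]
    constructor
    · rintro ((rfl | h) | h)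
      exacts [Or.inl hy, Or.inr h, Or.inl h]
    · rintro (h | h)
      exacts [Or.inr h, Or.inl (Or.inr h)]
  · intro f hf
    rw [Set.mem_ofPred_eq, List.map_append, List.mem_append] at hf
    rcases hf with hf | hf
    · exact Or.inr hf
    · exact Or.inl ((hpE f).2 (List.mem_cons_of_mem _ hf))

/-- A property of vertices and colours that is preserved when an edge of a tour is traversed holds
all along the tour. -/
lemma IsTour.propagate (h : IsTour G φ S E) {P : α → Fin 2 → Prop}
    (hP : ∀ e ∈ E, ∀ x y, G.IsLink e x y → P x (φ e) → P y (1 - φ e))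
    (hx : x ∈ S) (hxc : P x c) (he : e ∈ E) :
    ∃ y z, G.IsLink e y z ∧ P y (φ e) ∧ P z (1 - φ e) := by
  obtain ⟨f, hf, y, hl, rfl⟩ := h.exists_link hx c
  obtain ⟨p, hp, -, -, hpE⟩ := h.exists_open hf hl
  exact AltWalk.propagate (p := (f, y) :: p) ⟨hl, rfl, hp⟩ (fun g hg => hP g ((hpE g).2 hg)) hxc
    ((hpE e).1 he)

/-- Tours are connected. -/
lemma IsTour.exists_boundary (h : IsTour G φ S E) {N : Set α} (hx : x ∈ S) (hxN : x ∈ N)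
    (hy : y ∈ S) (hyN : y ∉ N) : ∃ e ∈ E, ∃ v w, G.IsLink e v w ∧ v ∈ N ∧ w ∉ N := by
  by_contra! hcon
  obtain ⟨e, he, z, hl, -⟩ := h.exists_link hy 0
  obtain ⟨v, w, hl', hv, hw⟩ := h.propagate (P := fun v _ => v ∈ N) (c := 0)
    (fun e he v w hl hv => hcon e he v w hl hv) hx hxN he
  rcases hl.left_eq_or_eq hl' with rfl | rfl
  exacts [hyN hv, hyN hw]

/-! ### Colour adjacency in extensions of M-closed graphs -/

/-- `x` and `y` are joined by an edge of colour `c`. -/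
def ColAdj (G : Graph α β) (φ : β → Fin 2) (c : Fin 2) (x y : α) : Prop :=
  ∃ e, G.IsLink e x y ∧ φ e = c

lemma ColAdj.symm (h : ColAdj G φ c x y) : ColAdj G φ c y x := by
  obtain ⟨e, hl, hc⟩ := h
  exact ⟨e, hl.symm, hc⟩

/-- The properties of an extension of an M-closed graph, in terms of the map that sends each vertex
to the one it replaces. -/
structure ExtendsMClosed (G : Graph α β) (φ : β → Fin 2) (π : α → γ) : Prop where
  ne : ∀ {c x y}, ColAdj G φ c x y → π x ≠ π y
  twin : ∀ {c x x' y}, ColAdj G φ c x y → x' ∈ V(G) → π x = π x' → ColAdj G φ c x' y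
  closed : ∀ {c x y z}, ColAdj G φ c x y → ColAdj G φ c y z → π x ≠ π z → ∃ d, ColAdj G φ d x z

/-- A monochromatic path of `G` whose ends are not twins projects to a monochromatic path of `M`,
and the edge of `M` that closes it lifts back. -/
lemma IsExtension.exists_extendsMClosed {M : Graph γ δ} {ψ : δ → Fin 2} (hclosed : MClosed M ψ)
    (h : IsExtension M ψ G φ) : ∃ π : α → γ, ExtendsMClosed G φ π := by
  obtain ⟨-, π, -, hind, hadj⟩ := h
  have hne : ∀ {c x y}, ColAdj G φ c x y → π x ≠ π y := by
    rintro c x y ⟨e, hl, -⟩ hπ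
    exact hind x hl.left_mem y hl.right_mem hπ hl.adj
  have hM : ∀ {c x y}, ColAdj G φ c x y → ∃ f, M.IsLink f (π x) (π y) ∧ ψ f = c := by
    intro c x y h
    obtain ⟨e, hl, -⟩ := id h
    exact (hadj x hl.left_mem y hl.right_mem (hne h) c).1 h
  refine ⟨π, hne, ?_, ?_⟩
  · intro c x x' y h hx' hπ
    obtain ⟨e, hl, -⟩ := id h
    refine (hadj x' hx' y hl.right_mem (hπ ▸ hne h) c).2 ?_
    rw [← hπ]
    exact hM h
  · intro c x y z h h' hπ
    obtain ⟨f, hf, hfc⟩ := hM h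
    obtain ⟨g, hg, hgc⟩ := hM h'
    obtain ⟨k, hk⟩ := hclosed _ _ _ f g (hne h) (hne h') hπ hf hg (hfc.trans hgc.symm)
    obtain ⟨e, hl, -⟩ := h
    obtain ⟨e', hl', -⟩ := h'
    exact ⟨ψ k, (hadj x hl.left_mem z hl'.right_mem hπ _).2 ⟨k, hk, rfl⟩⟩

variable {π : α → γ}

lemma ExtendsMClosed.link_ne (hG : ExtendsMClosed G φ π) (hl : G.IsLink e x y) : x ≠ y :=
  fun h => hG.ne ⟨e, hl, rfl⟩ (congrArg π h)

/-! ### Combining tours -/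

/-- A tour is combined with two disjoint tours that it meets and whose edges it does not use. -/
lemma IsTour.splice_two (hW : IsTour G φ W Q) (hS : IsTour G φ S E) (hT : IsTour G φ T F)
    (hST : Disjoint S T) (hQE : ∀ e ∈ Q, e ∉ E) (hQF : ∀ e ∈ Q, e ∉ F)
    (hxW : x ∈ W) (hx : x ∈ S) (hyW : y ∈ W) (hy : y ∈ T) :
    IsTour G φ (W ∪ S ∪ T) (Q ∪ E ∪ F) := by
  refine (hW.splice hS (Set.disjoint_left.2 hQE) hxW hx).splice hT ?_ (Or.inl hyW) hy
  rw [Set.disjoint_left]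
  rintro e (he | he)
  · exact hQF e he
  · exact Set.disjoint_left.1 (hS.disjoint_edges hT hST) he

/-- Two disjoint tours are combined by means of a third one that uses none of their edges. -/
lemma IsTour.bridge (hS : IsTour G φ S E) (hT : IsTour G φ T F) (hST : Disjoint S T)
    (hW : IsTour G φ W Q) (hQE : ∀ e ∈ Q, e ∉ E) (hQF : ∀ e ∈ Q, e ∉ F) (hsub : W ⊆ S ∪ T)
    (hxW : x ∈ W) (hx : x ∈ S) (hyW : y ∈ W) (hy : y ∈ T) : ∃ E', IsTour G φ (S ∪ T) E' := by
  have h := hW.splice_two hS hT hST hQE hQF hxW hx hyW hy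
  rw [Set.union_assoc, Set.union_eq_self_of_subset_left hsub] at h
  exact ⟨_, h⟩

/-- An edge of a tour is replaced by a walk of length three. -/
lemma IsTour.replace_edge_three (h : IsTour G φ S E) (he : e ∈ E) (hl : G.IsLink e x y)
    {a b : α} {f g k : β} (hf : G.IsLink f x a) (hg : G.IsLink g a b) (hk : G.IsLink k b y)
    (hfc : φ f = φ e) (hgc : φ g ≠ φ e) (hkc : φ k = φ e) (hfk : f ≠ k)
    (hfE : f ∉ E) (hgE : g ∉ E) (hkE : k ∉ E) :
    ∃ F, IsTour G φ (S ∪ {a, b}) F ∧ ∀ i ∈ F, i ∈ E ∨ i = f ∨ i = g ∨ i = k := by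
  have hfg : f ≠ g := by rintro rfl; exact hgc hfc
  have hgk : g ≠ k := by rintro rfl; exact hgc hkc
  obtain ⟨F, hF, hsub⟩ := h.replace_edge (q := [(f, a), (g, b), (k, y)]) he hl
    ⟨hf, hfc, hg, eq_one_sub_of_ne hgc, hk, by rw [one_sub_one_sub]; exact hkc, rfl,
      by rw [one_sub_one_sub]⟩ (by simp [hfg, hfk, hgk]) (by simp [hfE, hgE, hkE])
  refine ⟨F, ?_, by simpa using hsub⟩
  convert hF using 1
  ext v
  have := h.right_mem he hl
  simp only [Set.mem_union, Set.mem_insert_iff, Set.mem_singleton_iff, Set.mem_ofPred_eq,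
    List.map_cons, List.map_nil, List.mem_cons, List.not_mem_nil, or_false]
  constructor
  · tauto
  · rintro (h | h | h | rfl) <;> tauto

/-- Edges `xx'` and `yy'` of two disjoint tours are exchanged for `xy` and `x'y'`. -/
lemma IsTour.switch (hS : IsTour G φ S E) (hT : IsTour G φ T F) (hST : Disjoint S T)
    {f : β} {x' y' : α} (he : e ∈ E) (hl : G.IsLink e x x') (hne : x ≠ x') (hec : φ e = c)
    (hf : f ∈ F) (hl' : G.IsLink f y y') (hfc : φ f = c)
    (hxy : ColAdj G φ c x y) (hxy' : ColAdj G φ c x' y') : ∃ E', IsTour G φ (S ∪ T) E' := by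
  obtain ⟨p, hp, hpn, hpT, hpF⟩ := hT.exists_open hf hl'
  obtain ⟨g, hg, hgc⟩ := hxy
  obtain ⟨k, hk, hkc⟩ := hxy'
  rw [hfc] at hp
  have hxS := hS.left_mem he hl
  have hxS' := hS.right_mem he hl
  have hyT := hT.left_mem hf hl'
  have hyT' := hT.right_mem hf hl'
  have hdis := Set.disjoint_left.1 hST
  have hgE : g ∉ E := fun h => hdis (hS.right_mem h hg) hyT
  have hkE : k ∉ E := fun h => hdis (hS.right_mem h hk) hyT'
  have hgF : g ∉ F := fun h => hdis hxS (hT.left_mem h hg)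
  have hkF : k ∉ F := fun h => hdis hxS' (hT.left_mem h hk)
  have hgk : k ≠ g := by
    rintro rfl
    rcases hg.left_eq_or_eq hk with h | h
    · exact hne h
    · exact hdis hxS (h ▸ hyT')
  have hpF' : ∀ i ∈ p.map Prod.fst, i ∈ F := fun i hi => (hpF i).2 (List.mem_cons_of_mem _ hi)
  have hEF := Set.disjoint_left.1 (hS.disjoint_edges hT hST)
  -- The edge from `x'` to `x` becomes a detour: to `y'`, around the whole second tour to `y`, and
  -- on to `x`. It begins and ends with colour `c`, as the replaced edge does.
  obtain ⟨E', hE', -⟩ := hS.replace_edge (q := (k, y') :: p ++ [(g, x)]) he hl.symm (by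
      rw [hec]
      exact altWalk_append.2 ⟨y, c, ⟨hk, hkc, hp⟩, hg.symm, hgc, rfl, rfl⟩) (by
      rw [List.map_append]
      refine List.Nodup.append ?_ (by simp) ?_
      · exact List.nodup_cons.2 ⟨fun h => hkF (hpF' _ h), (List.nodup_cons.1 hpn).2⟩
      · intro i hi hi'
        simp only [List.map_cons, List.map_nil, List.mem_cons, List.not_mem_nil, or_false] at hi'
        rw [List.map_cons, List.mem_cons] at hi
        subst hi'
        rcases hi with hi | hi
        · exact hgk hi.symm
        · exact hgF (hpF' _ hi)) (by
      intro i hi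
      rw [List.map_append, List.mem_append, List.map_cons, List.mem_cons] at hi
      simp only [List.map_cons, List.map_nil, List.mem_cons, List.not_mem_nil, or_false] at hi
      rcases hi with (rfl | hi) | rfl
      · exact hkE
      · exact fun h => hEF h (hpF' _ hi)
      · exact hgE)
  refine ⟨E', ?_⟩
  convert hE' using 1
  ext v
  have := hpT v
  rw [List.mem_cons] at this
  simp only [Set.mem_union, Set.mem_ofPred_eq, List.map_append, List.map_cons, List.map_nil,
    List.mem_append, List.mem_cons, List.not_mem_nil, or_false]
  constructor
  · tauto
  · rintro (h | h | rfl) <;> tauto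

/-! ### Pairs of tours that cannot be combined -/

/-- Disjoint tours whose vertex sets cannot be covered by a single tour. -/
structure Unmergeable (G : Graph α β) (φ : β → Fin 2) (S T : Set α) (E F : Set β) : Prop where
  left : IsTour G φ S E
  right : IsTour G φ T F
  disjoint : Disjoint S T
  not_isTour : ∀ E', ¬ IsTour G φ (S ∪ T) E'

namespace Unmergeable

variable {x' y' : α} {f : β}

lemma symm (h : Unmergeable G φ S T E F) : Unmergeable G φ T S F E :=
  ⟨h.right, h.left, h.disjoint.symm, fun E' => by rw [Set.union_comm]; exact h.not_isTour E'⟩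

lemma ne (h : Unmergeable G φ S T E F) (hx : x ∈ S) (hy : y ∈ T) : x ≠ y := by
  rintro rfl
  exact Set.disjoint_left.1 h.disjoint hx hy

lemma notMem_left (h : Unmergeable G φ S T E F) (hl : G.IsLink e x y) (hy : y ∈ T) : e ∉ E :=
  fun he => h.ne (h.left.right_mem he hl) hy rfl

lemma notMem_right (h : Unmergeable G φ S T E F) (hl : G.IsLink e x y) (hx : x ∈ S) : e ∉ F :=
  h.symm.notMem_left hl.symm hx

/-- Two parallel edges of different colours form a closed trail of length two that bridges the
tours. -/
lemma colour_unique (h : Unmergeable G φ S T E F) (hx : x ∈ S) (hy : y ∈ T)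
    (hc : ColAdj G φ c x y) (hd : ColAdj G φ d x y) : c = d := by
  obtain ⟨e, he, rfl⟩ := hc
  obtain ⟨f, hf, rfl⟩ := hd
  by_contra hne
  have hW : IsTour G φ {y, x} {e, f} := by
    refine ⟨x, φ e, [(e, y), (f, x)], by simp, ⟨he, rfl, hf.symm, ?_, rfl, ?_⟩, ?_, ?_, ?_⟩
    · exact eq_one_sub_of_ne (Ne.symm hne)
    · exact one_sub_one_sub _
    · have : e ≠ f := fun h => hne (congrArg φ h)
      simpa using this
    · simp
    · simp
  obtain ⟨E', hE'⟩ := h.left.bridge h.right h.disjoint hW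
    (by rintro i (rfl | rfl); exacts [h.notMem_left he hy, h.notMem_left hf hy])
    (by rintro i (rfl | rfl); exacts [h.notMem_right he hx, h.notMem_right hf hx])
    (by rintro i (rfl | rfl); exacts [Or.inr hy, Or.inl hx])
    (x := x) (y := y) (by simp) hx (by simp) hy
  exact h.not_isTour _ hE'

lemma not_colAdj (h : Unmergeable G φ S T E F) (hG : ExtendsMClosed G φ π)
    (he : e ∈ E) (hl : G.IsLink e x x') (hec : φ e = c) (hf : f ∈ F) (hl' : G.IsLink f y y')
    (hfc : φ f = c) (hxy : ColAdj G φ c x y) : ¬ ColAdj G φ c x' y' := fun hxy' => by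
  obtain ⟨E', hE'⟩ := h.left.switch h.right h.disjoint he hl (hG.link_ne hl) hec hf hl' hfc hxy hxy'
  exact h.not_isTour _ hE'

/-- Twins could exchange their tour neighbours along colour 0, which is a switch. -/
lemma not_twin (h : Unmergeable G φ S T E F) (hG : ExtendsMClosed G φ π)
    (hx : x ∈ S) (hy : y ∈ T) : π x ≠ π y := by
  intro hπ
  obtain ⟨e, he, x', hl, hc⟩ := h.left.exists_link hx 0
  obtain ⟨f, hf, y', hl', hc'⟩ := h.right.exists_link hy 0
  refine h.not_colAdj hG he hl hc hf hl'.symm hc' ?_ ?_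
  · exact hG.twin ⟨f, hl', hc'⟩ (h.left.subset hx) hπ.symm
  · exact (hG.twin ⟨e, hl, hc⟩ (h.right.subset hy) hπ).symm

/-- Since there are no twins across the two tours, the exception in `closed` never occurs; `z` may
be any vertex. -/
lemma exists_colAdj (h : Unmergeable G φ S T E F) (hG : ExtendsMClosed G φ π)
    (hx : x ∈ S) (hy : y ∈ T) (hxz : ColAdj G φ c x z) (hzy : ColAdj G φ c z y) :
    ∃ d, ColAdj G φ d x y :=
  hG.closed hxz hzy (h.not_twin hG hx hy)

end Unmergeable

/-- `x ∈ S` has neighbours in `T`, and all edges from `x` to `T` have colour `c`. -/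
def Mono (G : Graph α β) (φ : β → Fin 2) (S T : Set α) (x : α) (c : Fin 2) : Prop :=
  x ∈ S ∧ (∃ y ∈ T, ColAdj G φ c x y) ∧ ∀ y ∈ T, ∀ d, ColAdj G φ d x y → d = c

/-- `x` is joined to all vertices in `T` by edges of colour `c`. -/
def Full (G : Graph α β) (φ : β → Fin 2) (T : Set α) (x : α) (c : Fin 2) : Prop :=
  ∀ y ∈ T, ColAdj G φ c x y

/-- Each vertex in `S` is joined to all vertices in `T` by edges of one colour. -/
def Dominates (G : Graph α β) (φ : β → Fin 2) (S T : Set α) : Prop :=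
  ∀ x ∈ S, ∃ c, Full G φ T x c

lemma exists_colAdj_of_not_mono (hm : ∀ x c, ¬ Mono G φ S T x c) (hx : x ∈ S)
    (hy : y ∈ T) (h : ColAdj G φ d x y) (c : Fin 2) : ∃ z ∈ T, ColAdj G φ c x z := by
  by_cases hdc : d = c
  · exact ⟨y, hy, hdc ▸ h⟩
  · by_contra! hcon
    refine hm x d ⟨hx, ⟨y, hy, h⟩, fun z hz b hb => ?_⟩
    by_contra hbd
    refine hcon z hz ?_
    rwa [eq_one_sub_of_ne (Ne.symm hdc), ← eq_one_sub_of_ne hbd]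

namespace Unmergeable

variable {x' y' : α} {f : β}

open Classical in
/-- If every vertex incident with an edge between `S` and `T` is incident with such edges of both
colours, then these edges contain an alternating closed trail. -/
lemma exists_mono (h : Unmergeable G φ S T E F) (hx : x ∈ S) (hy : y ∈ T)
    (hxy : ColAdj G φ c x y) : (∃ v b, Mono G φ S T v b) ∨ ∃ v b, Mono G φ T S v b := by
  by_contra! hm
  obtain ⟨hmS, hmT⟩ := hm
  let N : Set α := {v | (v ∈ S ∧ ∃ w ∈ T, ∃ d, ColAdj G φ d v w) ∨
    (v ∈ T ∧ ∃ w ∈ S, ∃ d, ColAdj G φ d v w)}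
  -- Leaving `S` only by colour 0 and `T` only by colour 1 makes every walk that follows this rule
  -- alternate.
  let col : α → Fin 2 := fun v => if v ∈ S then 0 else 1
  have hdis := Set.disjoint_right.1 h.disjoint
  have hstep : ∀ v ∈ N, ∃ (e : β) (w : α), w ∈ N ∧ G.IsLink e v w ∧ φ e = col v ∧
      ((v ∈ S ∧ w ∈ T) ∨ (v ∈ T ∧ w ∈ S)) := by
    rintro v (⟨hv, w, hw, d, hd⟩ | ⟨hv, w, hw, d, hd⟩)
    · obtain ⟨z, hz, e, hl, he⟩ := exists_colAdj_of_not_mono hmS hv hw hd 0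
      exact ⟨e, z, Or.inr ⟨hz, v, hv, 0, e, hl.symm, he⟩, hl, by simp [col, hv, he],
        Or.inl ⟨hv, hz⟩⟩
    · obtain ⟨z, hz, e, hl, he⟩ := exists_colAdj_of_not_mono hmT hv hw hd 1
      exact ⟨e, z, Or.inl ⟨hz, v, hv, 1, e, hl.symm, he⟩, hl, by simp [col, hdis hv, he],
        Or.inr ⟨hv, hz⟩⟩
  have hx₀ : x ∈ N := Or.inl ⟨hx, y, hy, c, hxy⟩
  obtain ⟨e₀, -⟩ := hxy
  have : Nonempty α := ⟨x⟩
  have : Nonempty β := ⟨e₀⟩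
  choose! g s hs hlink hcol hside using hstep
  have hcol' : ∀ v ∈ N, col (s v) = 1 - col v := by
    intro v hv
    rcases hside v hv with ⟨h1, h2⟩ | ⟨h1, h2⟩
    · simp [col, h1, hdis h2]
    · simp [col, h2, hdis h1]
  have hiter : ∀ v ∈ N, ∀ n, s^[n] v ∈ N := by
    intro v hv n
    induction n with
    | zero => exact hv
    | succ n ih => rw [Function.iterate_succ_apply']; exact hs _ ih
  have hfin : N.Finite := (h.left.finite.union h.right.finite).subset (by
    rintro v (⟨hv, -⟩ | ⟨hv, -⟩)
    exacts [Or.inl hv, Or.inr hv])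
  -- The successor map on the finite set `N` has a periodic point; its orbit is the closed trail
  -- sought.
  obtain ⟨m, n, hmn, heq⟩ := hfin.exists_lt_map_eq_of_forall_mem (f := fun n => s^[n] x)
    (hiter x hx₀)
  obtain ⟨v, hv, hper⟩ : ∃ v ∈ N, v ∈ Function.periodicPts s := by
    refine ⟨s^[m] x, hiter x hx₀ m, Function.mk_mem_periodicPts (Nat.sub_pos_of_lt hmn) ?_⟩
    rw [Function.IsPeriodicPt, Function.IsFixedPt, ← Function.iterate_add_apply,
      Nat.sub_add_cancel hmn.le]
    exact heq.symm
  have hpos := Function.minimalPeriod_pos_of_mem_periodicPts hper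
  have hinj := Function.iterate_injOn_Iio_minimalPeriod (f := s) (x := v)
  have hend := Function.iterate_minimalPeriod (f := s) (x := v)
  revert hpos hinj hend
  generalize Function.minimalPeriod s v = k
  intro hpos hinj hend
  have hwalk : ∀ n, AltWalk G φ v (col v)
      ((List.range n).map fun i => (g (s^[i] v), s^[i + 1] v)) (s^[n] v) (col (s^[n] v)) := by
    intro n
    induction n with
    | zero => exact ⟨rfl, rfl⟩
    | succ n ih =>
      rw [List.range_succ, List.map_append]
      have hn := hiter v hv n
      refine altWalk_append.2 ⟨_, _, ih, ?_, hcol _ hn, ?_, ?_⟩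
      · change G.IsLink (g (s^[n] v)) (s^[n] v) (s^[n + 1] v)
        rw [Function.iterate_succ_apply']
        exact hlink _ hn
      · rfl
      · rw [Function.iterate_succ_apply', hcol' _ hn]
  -- The colour of an edge determines the side from which it is used, so distinct vertices of the
  -- orbit use distinct edges.
  have hginj : ∀ a ∈ N, ∀ b ∈ N, g a = g b → a = b := by
    intro a ha b hb hab
    have h1 := hlink a ha
    rw [hab] at h1
    rcases h1.eq_and_eq_or_eq_and_eq (hlink b hb) with ⟨h2, -⟩ | ⟨h2, -⟩
    · exact h2
    · have h3 := hcol a ha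
      rw [hab, hcol b hb, h2, hcol' b hb] at h3
      exact absurd h3.symm (one_sub_ne _)
  have hw := hwalk k
  rw [hend] at hw
  let p := (List.range k).map fun i => (g (s^[i] v), s^[i + 1] v)
  have hW : IsTour G φ {w | w ∈ p.map Prod.snd} {e | e ∈ p.map Prod.fst} := by
    refine ⟨v, col v, p, by simp [p, hpos.ne'], hw, ?_, fun w => Iff.rfl, fun e => Iff.rfl⟩
    simp only [p, List.map_map]
    refine List.Nodup.map_on ?_ List.nodup_range
    intro i hi j hj hij
    exact hinj (List.mem_range.1 hi) (List.mem_range.1 hj)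
      (hginj _ (hiter v hv i) _ (hiter v hv j) hij)
  have hWN : ∀ w ∈ p.map Prod.snd, w ∈ N := by
    intro w hw
    simp only [p, List.map_map, List.mem_map] at hw
    obtain ⟨i, -, rfl⟩ := hw
    exact hiter v hv (i + 1)
  have hQ : ∀ e ∈ p.map Prod.fst, ∃ a ∈ S, ∃ b ∈ T, G.IsLink e a b := by
    intro e he
    simp only [p, List.map_map, List.mem_map] at he
    obtain ⟨i, -, rfl⟩ := he
    have hi := hiter v hv i
    rcases hside _ hi with ⟨h1, h2⟩ | ⟨h1, h2⟩
    · exact ⟨_, h1, _, h2, hlink _ hi⟩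
    · exact ⟨_, h2, _, h1, (hlink _ hi).symm⟩
  have hmem : g v ∈ p.map Prod.fst := by
    simp only [p, List.map_map, List.mem_map]
    exact ⟨0, List.mem_range.2 hpos, rfl⟩
  obtain ⟨a, ha, b, hb, hab⟩ := hQ _ hmem
  obtain ⟨E', hE'⟩ := h.left.bridge h.right h.disjoint hW
    (fun e he => by
      obtain ⟨a, ha, b, hb, hl⟩ := hQ e he
      exact h.notMem_left hl hb)
    (fun e he => by
      obtain ⟨a, ha, b, hb, hl⟩ := hQ e he
      exact h.notMem_right hl ha)
    (fun w hw => by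
      rcases hWN w hw with ⟨hw, -⟩ | ⟨hw, -⟩
      exacts [Or.inl hw, Or.inr hw])
    (hW.left_mem hmem hab) ha (hW.right_mem hmem hab) hb
  exact h.not_isTour _ hE'

/-- A vertex with monochromatic edges to `T` and as many neighbours in `T` as possible is joined to
all of `T`. -/
lemma exists_full (h : Unmergeable G φ S T E F) (hG : ExtendsMClosed G φ π)
    (hm : Mono G φ S T x c) : ∃ v ∈ S, ∃ b, Full G φ T v b := by
  induction hk : (T \ {y | ColAdj G φ c x y}).ncard using Nat.strong_induction_on
    generalizing x c with
  | _ k ih =>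
  obtain ⟨hx, ⟨y, hy, hxy⟩, hmono⟩ := hm
  by_cases hfull : Full G φ T x c
  · exact ⟨x, hx, c, hfull⟩
  have hnbr : ∀ {v w}, v ∈ T → w ∈ T → ColAdj G φ c x v → ColAdj G φ c v w → ColAdj G φ c x w := by
    intro v w hv hw h1 h2
    obtain ⟨d, hd⟩ := h.exists_colAdj hG hx hw h1 h2
    exact hmono w hw d hd ▸ hd
  -- The tour neighbour `x'` of `x` turns out to be monochromatic of colour `1 - c` with strictly
  -- more neighbours in `T`.
  obtain ⟨e, he, x', hl, hec⟩ := h.left.exists_link hx c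
  have hx' := h.left.right_mem he hl
  have hopp : ∀ v ∈ T, ColAdj G φ c x v → ColAdj G φ (1 - c) x' v := by
    intro v hv hxv
    obtain ⟨f, hf, w, hl', hfc⟩ := h.right.exists_link hv c
    have hw := h.right.right_mem hf hl'
    obtain ⟨d, hd⟩ := h.exists_colAdj hG hx' hv ⟨e, hl.symm, hec⟩ hxv
    have hdc : d ≠ c := by
      rintro rfl
      exact h.not_colAdj hG he hl hec hf hl'.symm hfc (hnbr hv hw hxv ⟨f, hl', hfc⟩) hd
    rwa [← eq_one_sub_of_ne hdc]
  have hmono' : ∀ w ∈ T, ∀ d, ColAdj G φ d x' w → d = 1 - c := by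
    intro w hw d hd
    refine eq_one_sub_of_ne ?_
    rintro rfl
    obtain ⟨b, hb⟩ := h.exists_colAdj hG hx hw ⟨e, hl, hec⟩ hd
    have hxw : ColAdj G φ d x w := hmono w hw b hb ▸ hb
    exact one_sub_ne d (h.colour_unique hx' hw (hopp w hw hxw) hd)
  obtain ⟨z, hz, hxz⟩ : ∃ z ∈ T, ¬ ColAdj G φ c x z := by
    simpa [Full] using hfull
  -- The tour on `T` leaves the neighbourhood of `x`, necessarily by an edge of colour `1 - c`;
  -- closedness along `x'`, `v`, `w` gives the additional neighbour `w` of `x'`.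
  obtain ⟨f, hf, v, w, hvw, hv, hw⟩ := h.right.exists_boundary
    (N := {y | ColAdj G φ c x y}) hy hxy hz hxz
  have hvT := h.right.left_mem hf hvw
  have hwT := h.right.right_mem hf hvw
  have hfc : φ f = 1 - c := by
    refine eq_one_sub_of_ne fun hfc => hw ?_
    exact hnbr hvT hwT hv ⟨f, hvw, hfc⟩
  have hx'w : ColAdj G φ (1 - c) x' w := by
    obtain ⟨d, hd⟩ := h.exists_colAdj hG hx' hwT (hopp v hvT hv) ⟨f, hvw, hfc⟩
    exact hmono' w hwT d hd ▸ hd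
  refine ih _ ?_ ⟨hx', ⟨y, hy, hopp y hy hxy⟩, hmono'⟩ rfl
  rw [← hk]
  refine Set.ncard_lt_ncard ?_ (h.right.finite.subset Set.sdiff_subset)
  refine (Set.ssubset_iff_of_subset ?_).2 ⟨w, ⟨hwT, hw⟩, fun h => h.2 hx'w⟩
  rintro a ⟨ha, ha'⟩
  exact ⟨ha, fun h => ha' (hopp a ha h)⟩

/-- Closedness along `y`, `x`, `v` joins `y` to `v`. Colour `φ e` would allow a switch of `e` with
an edge of that colour at `v` in the other tour. -/
lemma full_next (h : Unmergeable G φ S T E F) (hG : ExtendsMClosed G φ π) (he : e ∈ E)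
    (hl : G.IsLink e x y) (hx : Full G φ T x (φ e)) : Full G φ T y (1 - φ e) := by
  intro v hv
  obtain ⟨f, hf, w, hl', hfc⟩ := h.right.exists_link hv (φ e)
  obtain ⟨d, hd⟩ := h.exists_colAdj hG (h.left.right_mem he hl) hv ⟨e, hl.symm, rfl⟩ (hx v hv)
  have hdc : d ≠ φ e := by
    rintro rfl
    exact h.not_colAdj hG he hl rfl hf hl'.symm hfc (hx w (h.right.right_mem hf hl')) hd
  rwa [← eq_one_sub_of_ne hdc]

lemma full_unique (h : Unmergeable G φ S T E F) (hx : x ∈ S) (hc : Full G φ T x c)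
    (hd : Full G φ T x d) : c = d := by
  obtain ⟨y, hy⟩ := h.right.nonempty
  exact h.colour_unique hx hy (hc y hy) (hd y hy)

/-- Traverse the tour from `x` in the direction whose first edge has colour `c`: then `full_next`
applies at each step, as its colour flips together with the colour due next. -/
lemma dominates_of_full (h : Unmergeable G φ S T E F) (hG : ExtendsMClosed G φ π) (hx : x ∈ S)
    (hc : Full G φ T x c) : Dominates G φ S T := by
  intro v hv
  obtain ⟨e, he, w, hl, -⟩ := h.left.exists_link hv 0
  obtain ⟨a, b, hab, ha, hb⟩ := h.left.propagate (P := Full G φ T)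
    (fun e he x y hl hx => h.full_next hG he hl hx) hx hc he
  rcases hl.left_eq_or_eq hab with rfl | rfl
  exacts [⟨_, ha⟩, ⟨_, hb⟩]

lemma dominates_or_dominates (h : Unmergeable G φ S T E F) (hG : ExtendsMClosed G φ π)
    (hx : x ∈ S) (hy : y ∈ T) (hxy : ColAdj G φ c x y) :
    Dominates G φ S T ∨ Dominates G φ T S := by
  rcases h.exists_mono hx hy hxy with ⟨v, b, hm⟩ | ⟨v, b, hm⟩
  · obtain ⟨w, hw, d, hd⟩ := h.exists_full hG hm
    exact Or.inl (h.dominates_of_full hG hw hd)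
  · obtain ⟨w, hw, d, hd⟩ := h.symm.exists_full hG hm
    exact Or.inr (h.symm.dominates_of_full hG hw hd)

/-- The colour changes along each edge of the dominating tour. -/
lemma full_flip (h : Unmergeable G φ S T E F) (hG : ExtendsMClosed G φ π) (he : e ∈ E)
    (hl : G.IsLink e x y) (hx : Full G φ T x c) : Full G φ T y (1 - c) := by
  have hxS := h.left.left_mem he hl
  obtain ⟨a, b, hab, ha, hb⟩ := h.left.propagate (P := Full G φ T)
    (fun e he x y hl hx => h.full_next hG he hl hx) hxS hx he
  rcases hl.eq_and_eq_or_eq_and_eq hab with ⟨rfl, rfl⟩ | ⟨rfl, rfl⟩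
  · rwa [h.full_unique hxS hx ha]
  · rwa [h.full_unique hxS hx hb, one_sub_one_sub]

lemma exists_full_colour (h : Unmergeable G φ S T E F) (hG : ExtendsMClosed G φ π)
    (hD : Dominates G φ S T) (c : Fin 2) : ∃ x ∈ S, Full G φ T x c := by
  obtain ⟨x, hx⟩ := h.left.nonempty
  obtain ⟨d, hd⟩ := hD x hx
  by_cases hdc : d = c
  · exact ⟨x, hx, hdc ▸ hd⟩
  · obtain ⟨e, he, y, hl, -⟩ := h.left.exists_link hx 0
    refine ⟨y, h.left.right_mem he hl, ?_⟩
    rw [eq_one_sub_of_ne (Ne.symm hdc)]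
    exact h.full_flip hG he hl hd

end Unmergeable

variable {H : Set β}

/-! ### Dominating tours -/

namespace Unmergeable

/-- Both colours occur on each side, so an edge between a 0-vertex of `S` and a 1-vertex of `T`
would need both colours. -/
lemma not_dominates (h : Unmergeable G φ S T E F) (hG : ExtendsMClosed G φ π)
    (hD : Dominates G φ S T) : ¬ Dominates G φ T S := by
  intro hD'
  obtain ⟨x, hx, hxc⟩ := h.exists_full_colour hG hD 0
  obtain ⟨y, hy, hyc⟩ := h.symm.exists_full_colour hG hD' 1
  exact absurd (h.colour_unique hx hy (hxc y hy) (hyc x hx).symm) (by decide)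

/-- A tour that dominates `T` has edges to each tour that `T` has edges to. -/
lemma exists_colAdj_of_dominates (h : Unmergeable G φ S T E F) (h' : Unmergeable G φ S U E H)
    (hG : ExtendsMClosed G φ π) (hD : Dominates G φ S T) (hy : y ∈ T) (hz : z ∈ U)
    (hyz : ColAdj G φ c y z) : ∃ x ∈ S, ∃ d, ColAdj G φ d x z := by
  obtain ⟨x, hx, hxc⟩ := h.exists_full_colour hG hD c
  exact ⟨x, hx, h'.exists_colAdj hG hx hz (hxc y hy) hyz⟩

/-- Vertices of a dominating tour with the same colour are not joined by an edge of the other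
colour. -/
lemma full_ne_of_isLink (h : Unmergeable G φ S T E F) (hG : ExtendsMClosed G φ π)
    (hx : x ∈ S) (hy : y ∈ S) (hl : G.IsLink e x y) (hxc : Full G φ T x c)
    (hyc : Full G φ T y c) : φ e = c := by
  by_contra hec
  have heE : e ∉ E := by
    intro he
    exact one_sub_ne c (h.full_unique hy (h.full_flip hG he hl hxc) hyc)
  obtain ⟨v, hv⟩ := h.right.nonempty
  obtain ⟨f, hf, w, hl', rfl⟩ := h.right.exists_link hv c
  have hw := h.right.right_mem hf hl'
  obtain ⟨g, hg, hgc⟩ := (hxc v hv).symm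
  obtain ⟨k, hk, hkc⟩ := hyc w hw
  have hgk : g ≠ k := by
    rintro rfl
    rcases hg.right_eq_or_eq hk with h1 | h1
    · exact hG.link_ne hl h1
    · exact h.ne hx hw h1
  have heF := h.notMem_right hl hx
  -- Detour the edge `vw` of the dominated tour through `x` and `y`; the result meets `S` and can be
  -- spliced with its tour.
  obtain ⟨F', hF', hsub⟩ := h.right.replace_edge_three hf hl' hg hl hk hgc hec hkc hgk
    (h.notMem_right hg.symm hx) heF (h.notMem_right hk hy)
  have hdis : Disjoint F' E := by
    rw [Set.disjoint_left]
    intro i hi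
    rcases hsub i hi with hi | rfl | rfl | rfl
    · exact Set.disjoint_right.1 (h.left.disjoint_edges h.right h.disjoint) hi
    · exact h.notMem_left hg.symm hv
    · exact heE
    · exact h.notMem_left hk hw
  have := hF'.splice h.left hdis (x := x) (by simp) hx
  refine h.not_isTour (F' ∪ E) ?_
  convert this using 1
  ext i
  simp only [Set.mem_union, Set.mem_insert_iff, Set.mem_singleton_iff]
  constructor
  · tauto
  · rintro ((h | rfl | rfl) | h) <;> tauto

end Unmergeable

/-- Three tours that dominate each other cyclically can be combined. -/
lemma exists_isTour_of_dominates_cyclically (hST : Unmergeable G φ S T E F)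
    (hTU : Unmergeable G φ T U F H) (hUS : Unmergeable G φ U S H E) (hG : ExtendsMClosed G φ π)
    (hS : Dominates G φ S T) (hT : Dominates G φ T U) (hU : Dominates G φ U S) :
    ∃ E', IsTour G φ (S ∪ T ∪ U) E' := by
  obtain ⟨z', hz', hz'c⟩ := hUS.exists_full_colour hG hU 0
  obtain ⟨x, hx, hxc⟩ := hST.exists_full_colour hG hS 1
  obtain ⟨y, hy, hyc⟩ := hTU.exists_full_colour hG hT 0
  obtain ⟨e, he, z, hl, hec⟩ := hTU.right.exists_link hz' 0
  have hz := hTU.right.right_mem he hl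
  obtain ⟨f, hf, hfc⟩ := (hyc z hz).symm
  obtain ⟨g, hg, hgc⟩ := (hxc y hy).symm
  obtain ⟨k, hk, hkc⟩ := (hz'c x hx).symm
  have hfk : f ≠ k := by
    rintro rfl
    rcases hf.right_eq_or_eq hk with h1 | h1
    · exact hST.ne hx hy h1.symm
    · exact hTU.ne hy hz' h1
  -- The edge `zz'` of the tour on `U` is detoured through `y` in `T` and `x` in `S`, with colours
  -- 0, 1, 0.
  obtain ⟨F', hF', hsub⟩ := hTU.right.replace_edge_three he hl.symm hf hg hk (by rw [hfc, hec])
    (by rw [hgc, hec]; decide) (by rw [hkc, hec]) hfk (hTU.notMem_right hf.symm hy)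
    (hTU.notMem_right hg hy) (hUS.notMem_left hk.symm hx)
  have h := hF'.splice_two hST.left hST.right hST.disjoint (x := x) (y := y)
    (fun i hi => by
      rcases hsub i hi with hi | rfl | rfl | rfl
      · exact Set.disjoint_left.1 (hUS.left.disjoint_edges hUS.right hUS.disjoint) hi
      · exact hUS.notMem_right hf hz
      · exact hST.notMem_left hg.symm hy
      · exact hUS.notMem_right hk.symm hz')
    (fun i hi => by
      rcases hsub i hi with hi | rfl | rfl | rfl
      · exact Set.disjoint_right.1 (hTU.left.disjoint_edges hTU.right hTU.disjoint) hi
      · exact hTU.notMem_left hf.symm hz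
      · exact hST.notMem_right hg.symm hx
      · exact hTU.notMem_left hk hz')
    (by simp) hx (by simp) hy
  refine ⟨F' ∪ E ∪ F, ?_⟩
  convert h using 1
  ext i
  simp only [Set.mem_union, Set.mem_insert_iff, Set.mem_singleton_iff]
  constructor
  · tauto
  · rintro (((h | rfl | rfl) | h) | h) <;> tauto

/-- If some vertex of a tour is joined to two dominated tours by edges of different colours, then
the three tours can be combined. -/
lemma exists_isTour_of_full_of_full (hST : Unmergeable G φ S T E F)
    (hSU : Unmergeable G φ S U E H) (hTU : Disjoint T U) (hG : ExtendsMClosed G φ π)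
    (hx : x ∈ S) (hxT : Full G φ T x c) (hxU : Full G φ U x (1 - c)) :
    ∃ E', IsTour G φ (S ∪ T ∪ U) E' := by
  obtain ⟨e, he, x', hl, -⟩ := hST.left.exists_link hx 0
  have hx' := hST.left.right_mem he hl
  have hx'T := hST.full_flip hG he hl hxT
  have hx'U := hSU.full_flip hG he hl hxU
  rw [one_sub_one_sub] at hx'U
  obtain ⟨y, hy⟩ := hST.right.nonempty
  obtain ⟨z, hz⟩ := hSU.right.nonempty
  obtain ⟨f, hf, hfc⟩ := hxT y hy
  obtain ⟨g, hg, hgc⟩ := (hx'T y hy).symm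
  obtain ⟨k, hk, hkc⟩ := hx'U z hz
  obtain ⟨l, hll, hlc⟩ := (hxU z hz).symm
  have hyz : y ≠ z := by
    rintro rfl
    exact Set.disjoint_left.1 hTU hy hz
  have hne : ∀ {i j : β}, φ i = c → φ j = 1 - c → i ≠ j := by
    rintro i j hi hj rfl
    exact one_sub_ne c (hj.symm.trans hi)
  have hfk : f ≠ k := by
    rintro rfl
    rcases hf.right_eq_or_eq hk with h | h
    exacts [hST.ne hx' hy h.symm, hyz h]
  have hgl : g ≠ l := by
    rintro rfl
    rcases hg.left_eq_or_eq hll with h | h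
    exacts [hyz h, hST.ne hx hy h.symm]
  -- The 4-cycle `x`, `y`, `x'`, `z` alternates because both labels flip from `x` to its tour
  -- neighbour `x'`.
  have hW : IsTour G φ {y, x', z, x} {f, g, k, l} := by
    refine ⟨x, c, [(f, y), (g, x'), (k, z), (l, x)], by simp,
      ⟨hf, hfc, hg, hgc, hk, ?_, hll, ?_, rfl, ?_⟩, ?_, by simp, by simp⟩
    · rw [hkc, one_sub_one_sub]
    · rw [hlc, one_sub_one_sub]
    · rw [one_sub_one_sub, one_sub_one_sub]
    · simp [hne hfc hgc, hfk, hne hfc hlc, (hne hkc hgc).symm, hgl, hne hkc hlc]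
  have h₁ := hW.splice_two hST.left hST.right hST.disjoint (x := x) (y := y)
    (by
      rintro i (rfl | rfl | rfl | rfl)
      exacts [hST.notMem_left hf hy, hST.notMem_left hg.symm hy, hSU.notMem_left hk hz,
        hSU.notMem_left hll.symm hz])
    (by
      rintro i (rfl | rfl | rfl | rfl)
      exacts [hST.notMem_right hf hx, hST.notMem_right hg.symm hx', hST.notMem_right hk hx',
        hST.notMem_right hll.symm hx])
    (by simp) hx (by simp) hy
  have h₂ := h₁.splice hSU.right (by
    rw [Set.disjoint_left]
    rintro i (((rfl | rfl | rfl | rfl) | hi) | hi)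
    · exact hSU.notMem_right hf hx
    · exact hSU.notMem_right hg.symm hx'
    · exact hSU.notMem_right hk hx'
    · exact hSU.notMem_right hll.symm hx
    · exact Set.disjoint_left.1 (hSU.left.disjoint_edges hSU.right hSU.disjoint) hi
    · exact Set.disjoint_left.1 (hST.right.disjoint_edges hSU.right hTU) hi)
    (x := z) (by simp) hz
  refine ⟨{f, g, k, l} ∪ E ∪ F ∪ H, ?_⟩
  convert h₂ using 1
  ext i
  simp only [Set.mem_union, Set.mem_insert_iff, Set.mem_singleton_iff]
  constructor
  · tauto
  · rintro ((((rfl | rfl | rfl | rfl) | h) | h) | h) <;> tauto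

/-! ### Factors -/

/-- Pairwise disjoint vertex sets of tours that cover all vertices. -/
structure IsTourFactor (G : Graph α β) (φ : β → Fin 2) (𝒜 : Finset (Set α)) : Prop where
  disjoint : ∀ S ∈ 𝒜, ∀ T ∈ 𝒜, S ≠ T → Disjoint S T
  cover : ∀ v, v ∈ V(G) ↔ ∃ S ∈ 𝒜, v ∈ S
  isTour : ∀ S ∈ 𝒜, ∃ E, IsTour G φ S E

variable {𝒜 ℬ : Finset (Set α)}

open Classical in
lemma HasEulerianFactor.exists_isTourFactor (h : HasEulerianFactor G φ) :
    ∃ 𝒜, IsTourFactor G φ 𝒜 := by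
  obtain ⟨k, S, hdis, hcov, htour⟩ := h
  refine ⟨Finset.univ.image S, ?_, ?_, ?_⟩
  · intro A hA B hB hAB
    obtain ⟨i, -, rfl⟩ := Finset.mem_image.1 hA
    obtain ⟨j, -, rfl⟩ := Finset.mem_image.1 hB
    exact hdis i j fun h => hAB (congrArg S h)
  · intro v
    simp [← hcov]
  · intro A hA
    obtain ⟨i, -, rfl⟩ := Finset.mem_image.1 hA
    exact exists_isTour_of_supereulerian (htour i)

open Classical in
/-- Some members of a factor are replaced by their union. -/
lemma IsTourFactor.merge (h : IsTourFactor G φ 𝒜) (hsub : ℬ ⊆ 𝒜)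
    (hE : IsTour G φ (⋃₀ (ℬ : Set (Set α))) E) :
    IsTourFactor G φ (insert (⋃₀ (ℬ : Set (Set α))) (𝒜 \ ℬ)) := by
  have hd : ∀ S ∈ 𝒜 \ ℬ, Disjoint (⋃₀ (ℬ : Set (Set α))) S := by
    intro S hS
    rw [Finset.mem_sdiff] at hS
    rw [Set.disjoint_sUnion_left]
    intro T hT
    refine h.disjoint T (hsub hT) S hS.1 ?_
    rintro rfl
    exact hS.2 hT
  refine ⟨?_, ?_, ?_⟩
  · intro S hS T hT hne
    rw [Finset.mem_insert] at hS hT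
    rcases hS with rfl | hS <;> rcases hT with rfl | hT
    · exact absurd rfl hne
    · exact hd T hT
    · exact (hd S hS).symm
    · exact h.disjoint S (Finset.mem_sdiff.1 hS).1 T (Finset.mem_sdiff.1 hT).1 hne
  · intro v
    rw [h.cover]
    constructor
    · rintro ⟨S, hS, hv⟩
      by_cases hQ : S ∈ ℬ
      · exact ⟨_, Finset.mem_insert_self _ _, S, hQ, hv⟩
      · exact ⟨S, Finset.mem_insert_of_mem (Finset.mem_sdiff.2 ⟨hS, hQ⟩), hv⟩
    · rintro ⟨S, hS, hv⟩
      rcases Finset.mem_insert.1 hS with rfl | hS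
      · obtain ⟨T, hT, hv⟩ := hv
        exact ⟨T, hsub hT, hv⟩
      · exact ⟨S, (Finset.mem_sdiff.1 hS).1, hv⟩
  · intro S hS
    rcases Finset.mem_insert.1 hS with rfl | hS
    · exact ⟨E, hE⟩
    · exact h.isTour S (Finset.mem_sdiff.1 hS).1

open Classical in
/-- In a factor with as few members as possible no two or more members can be combined. -/
lemma IsTourFactor.not_isTour_sUnion (h : IsTourFactor G φ 𝒜)
    (hmin : ∀ ℬ, IsTourFactor G φ ℬ → 𝒜.card ≤ ℬ.card) (hsub : ℬ ⊆ 𝒜) (hcard : 1 < ℬ.card) :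
    ¬ IsTour G φ (⋃₀ (ℬ : Set (Set α))) E := by
  intro hE
  have h1 := hmin _ (h.merge hsub hE)
  have h2 := Finset.card_insert_le (⋃₀ (ℬ : Set (Set α))) (𝒜 \ ℬ)
  have h3 := Finset.card_sdiff_add_card_eq_card hsub
  omega

/-! ### Colour-connectedness and the dominating member -/

lemma exists_link_of_isWalk {p : List (β × α)} {u v : α} (h : IsWalk G u p v)
    (hu : u ∈ W) (hv : v ∉ W) : ∃ e x y, G.IsLink e x y ∧ x ∈ W ∧ y ∉ W := by
  induction p generalizing u with
  | nil => exact absurd (h.2 ▸ hu) hv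
  | cons s p ih =>
    by_cases hs : s.2 ∈ W
    · exact ih h.2 hs
    · exact ⟨_, _, _, h.1, hu, hs⟩

lemma AltWalk.invariant {p : List (β × α)} {u v : α} (h : AltWalk G φ u c p v d)
    {P : α → Fin 2 → Prop} (hP : ∀ e x y, G.IsLink e x y → P x (φ e) → P y (1 - φ e))
    (hu : P u c) : P v d := by
  induction p generalizing u c with
  | nil => obtain ⟨rfl, rfl⟩ := h; exact hu
  | cons s p ih =>
    obtain ⟨hl, rfl, h⟩ := h
    exact ih h (hP _ _ _ hl hu)

/-- Between any two vertices there are alternating walks with both colours of the first edge. -/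
lemma ColourConnected.exists_altWalk (h : ColourConnected G φ) (hx : x ∈ V(G)) (hy : y ∈ V(G))
    (hne : x ≠ y) (c : Fin 2) : ∃ p d, AltWalk G φ x c p y d := by
  obtain ⟨p, q, ⟨hp, -, hpa⟩, ⟨hq, -, hqa⟩, -, hpq⟩ := h x hx y hy hne
  have key : ∀ r : List (β × α), IsWalk G x r y → Alternates (colours φ r) →
      (colours φ r).head? = some c → ∃ p d, AltWalk G φ x c p y d := by
    intro r hr hra hrc
    obtain ⟨d, hd⟩ := exists_altWalk_of_isWalk (φ := φ) (c := c) hr hra (by simp [hrc])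
    exact ⟨r, d, hd⟩
  have hp0 : colours φ p ≠ [] := by
    intro h0
    rw [colours, List.map_eq_nil_iff] at h0
    subst h0
    exact hne hp.2
  have hq0 : colours φ q ≠ [] := by
    intro h0
    rw [colours, List.map_eq_nil_iff] at h0
    subst h0
    exact hne hq.2
  have hp1 := List.head?_eq_some_head hp0
  have hq1 := List.head?_eq_some_head hq0
  by_cases hc : (colours φ p).head hp0 = c
  · exact key p hp hpa (hc ▸ hp1)
  · refine key q hq hqa ?_
    have hne' : (colours φ q).head hq0 ≠ (colours φ p).head hp0 := by
      intro heq
      apply hpq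
      rw [List.getLast?_append, List.getLast?_reverse, List.head?_append, hp1, hq1, heq]
      rfl
    rw [hq1, eq_one_sub_of_ne hne', ← eq_one_sub_of_ne (Ne.symm hc)]

open Classical in
/-- A minimal factor with more than one member has a member that dominates all others. -/
lemma exists_dominating {E : Set α → Set β} (hG : ExtendsMClosed G φ π)
    (hconn : ColourConnected G φ) (h : IsTourFactor G φ 𝒜) (hne : 𝒜.Nonempty)
    (hum : ∀ S ∈ 𝒜, ∀ T ∈ 𝒜, S ≠ T → Unmergeable G φ S T (E S) (E T))
    (hthree : ∀ S ∈ 𝒜, ∀ T ∈ 𝒜, ∀ U ∈ 𝒜, S ≠ T → ∀ E', ¬ IsTour G φ (S ∪ T ∪ U) E') :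
    ∃ S ∈ 𝒜, ∀ T ∈ 𝒜, S ≠ T → Dominates G φ S T := by
  -- A member that dominates as many others as possible is dominated by none: a dominator of `S`
  -- would dominate `S` and everything that `S` dominates.
  obtain ⟨S, hS, hmax⟩ := 𝒜.exists_max_image
    (fun S => (𝒜.filter fun T => S ≠ T ∧ Dominates G φ S T).card) hne
  have hsource : ∀ L ∈ 𝒜, S ≠ L → ¬ Dominates G φ L S := by
    intro L hL hSL hD
    have hLS := hum L hL S hS hSL.symm
    refine (hmax L hL).not_gt (Finset.card_lt_card ?_)
    rw [Finset.ssubset_iff_of_subset]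
    · exact ⟨S, by simp [hS, hSL.symm, hD], by simp⟩
    · intro T hT
      rw [Finset.mem_filter] at hT ⊢
      obtain ⟨hT, hST, hDT⟩ := hT
      have hLT : L ≠ T := by
        rintro rfl
        exact hLS.not_dominates hG hD hDT
      refine ⟨hT, hLT, ?_⟩
      have hST' := hum S hS T hT hST
      have hLT' := hum L hL T hT hLT
      obtain ⟨x, hx, hxc⟩ := hST'.exists_full_colour hG hDT 0
      obtain ⟨y, hy⟩ := hST'.right.nonempty
      obtain ⟨w, hw, d, hd⟩ := hLS.exists_colAdj_of_dominates hLT' hG hD hx hy (hxc y hy)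
      rcases hLT'.dominates_or_dominates hG hw hy hd with h1 | h1
      · exact h1
      · obtain ⟨E', hE'⟩ := exists_isTour_of_dominates_cyclically hLS hST' hLT'.symm hG hD hDT h1
        exact absurd hE' (hthree L hL S hS T hT hSL.symm E')
  refine ⟨S, hS, ?_⟩
  have hadj : ∀ T ∈ 𝒜, S ≠ T → ∀ x ∈ S, ∀ y ∈ T, ∀ c, ColAdj G φ c x y → Dominates G φ S T := by
    intro T hT hST x hx y hy c hxy
    exact ((hum S hS T hT hST).dominates_or_dominates hG hx hy hxy).resolve_right
      (hsource T hT hST)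
  intro U hU hSU
  by_contra hDU
  -- `W` is, within `V(G)`, the union of `S` and the members that it dominates; an edge leaving `W`
  -- would make `S` adjacent to, hence dominate, a further member.
  let W : Set α := {w | ∀ R ∈ 𝒜, w ∈ R → S ≠ R → Dominates G φ S R}
  have hSU' := hum S hS U hU hSU
  obtain ⟨u, hu⟩ := hSU'.left.nonempty
  obtain ⟨v, hv⟩ := hSU'.right.nonempty
  obtain ⟨p, -, ⟨hp, -⟩, -⟩ := hconn u (hSU'.left.subset hu) v (hSU'.right.subset hv)
    (hSU'.ne hu hv)
  obtain ⟨e, a, b, hl, ha, hb⟩ := exists_link_of_isWalk (W := W) hp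
    (fun R hR huR hSR => absurd huR (Set.disjoint_left.1 (h.disjoint S hS R hR hSR) hu))
    (fun hW => hDU (hW U hU hv hSU))
  obtain ⟨A, hA, haA⟩ := (h.cover a).1 hl.left_mem
  have hb' : ∃ R ∈ 𝒜, b ∈ R ∧ S ≠ R ∧ ¬ Dominates G φ S R := by
    by_contra! hcon
    exact hb hcon
  obtain ⟨B, hB, hbB, hSB, hDB⟩ := hb'
  by_cases hSA : S = A
  · subst hSA
    exact hDB (hadj B hB hSB a haA b hbB _ ⟨e, hl, rfl⟩)
  · obtain ⟨x, hx, d, hd⟩ := (hum S hS A hA hSA).exists_colAdj_of_dominates (hum S hS B hB hSB) hG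
      (ha A hA haA hSA) haA hbB ⟨e, hl, rfl⟩
    exact hDB (hadj B hB hSB x hx b hbB d hd)

open Classical in
/-- A minimal factor of a colour-connected extension of an M-closed graph has only one member. -/
lemma IsTourFactor.eq_of_minimal (hG : ExtendsMClosed G φ π) (hconn : ColourConnected G φ)
    (h : IsTourFactor G φ 𝒜) (hmin : ∀ ℬ, IsTourFactor G φ ℬ → 𝒜.card ≤ ℬ.card)
    (hS : S ∈ 𝒜) (hT : T ∈ 𝒜) : S = T := by
  by_contra hST
  choose! E hE using h.isTour
  have hum : ∀ S ∈ 𝒜, ∀ T ∈ 𝒜, S ≠ T → Unmergeable G φ S T (E S) (E T) := by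
    intro S hS T hT hne
    refine ⟨hE S hS, hE T hT, h.disjoint S hS T hT hne, fun E' hE' => ?_⟩
    refine h.not_isTour_sUnion hmin (ℬ := {S, T}) (E := E') ?_ ?_ ?_
    · simp [Finset.insert_subset_iff, hS, hT]
    · rw [Finset.card_pair hne]; decide
    · simpa using hE'
  have hthree : ∀ S ∈ 𝒜, ∀ T ∈ 𝒜, ∀ U ∈ 𝒜, S ≠ T → ∀ E', ¬ IsTour G φ (S ∪ T ∪ U) E' := by
    intro S hS T hT U hU hne E' hE'
    refine h.not_isTour_sUnion hmin (ℬ := {S, T, U}) (E := E') ?_ ?_ ?_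
    · simp [Finset.insert_subset_iff, hS, hT, hU]
    · exact Finset.one_lt_card.2 ⟨S, by simp, T, by simp, hne⟩
    · simpa [Set.union_assoc] using hE'
  obtain ⟨R, hR, hdom⟩ := exists_dominating hG hconn h ⟨S, hS⟩ hum hthree
  obtain ⟨T, hT, hRT⟩ : ∃ T ∈ 𝒜, R ≠ T := by
    by_cases hRS : R = S
    · exact ⟨T, hT, hRS ▸ hST⟩
    · exact ⟨S, hS, hRS⟩
  have hRT' := hum R hR T hT hRT
  have hsame : ∀ U ∈ 𝒜, R ≠ U → ∀ x ∈ R, ∀ c, Full G φ T x c → Full G φ U x c := by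
    intro U hU hRU x hx c hc
    obtain ⟨d, hd⟩ := hdom U hU hRU x hx
    by_cases hdc : d = c
    · exact hdc ▸ hd
    · rw [eq_one_sub_of_ne hdc] at hd
      have hTU : T ≠ U := by
        rintro rfl
        exact one_sub_ne c (hRT'.full_unique hx hd hc)
      obtain ⟨E', hE'⟩ := exists_isTour_of_full_of_full hRT' (hum R hR U hU hRU)
        (h.disjoint T hT U hU hTU) hG hx hc hd
      exact absurd hE' (hthree R hR T hT U hU hRT E')
  obtain ⟨u, hu⟩ := hRT'.left.nonempty
  obtain ⟨v, hv⟩ := hRT'.right.nonempty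
  obtain ⟨b, hb⟩ := hdom T hT hRT u hu
  obtain ⟨p, d, hp⟩ := hconn.exists_altWalk (hRT'.left.subset hu) (hRT'.right.subset hv)
    (hRT'.ne hu hv) (1 - b)
  -- Invariant: the walk is in `R`, and the colour due next differs from the label of the current
  -- vertex.
  have hinv := hp.invariant (P := fun x c => x ∈ R ∧ Full G φ T x (1 - c)) ?_
    ⟨hu, by rwa [one_sub_one_sub]⟩
  · exact hRT'.ne hinv.1 hv rfl
  · rintro e x y hl ⟨hx, hxc⟩
    have hyR : y ∈ R := by
      by_contra hy
      obtain ⟨U, hU, hyU⟩ := (h.cover y).1 hl.right_mem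
      have hRU : R ≠ U := by
        rintro rfl
        exact hy hyU
      exact one_sub_ne _ ((hum R hR U hU hRU).colour_unique hx hyU
        (hsame U hU hRU x hx _ hxc y hyU) ⟨e, hl, rfl⟩)
    refine ⟨hyR, ?_⟩
    obtain ⟨a, ha⟩ := hdom T hT hRT y hyR
    by_cases hae : a = 1 - φ e
    · subst hae
      exact absurd (hRT'.full_ne_of_isLink hG hx hyR hl hxc ha) (one_sub_ne _).symm
    · rwa [← eq_one_sub_of_ne hae]

end TwoEdgeColoured

theorem mainTheorem8 {α β γ δ : Type*}
    (M : Graph γ δ) (ψ : δ → Fin 2) (hM : M.Loopless) (hclosed : TwoEdgeColoured.MClosed M ψ)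
    (G : Graph α β) (φ : β → Fin 2) (hext : TwoEdgeColoured.IsExtension M ψ G φ)
    (hconn : TwoEdgeColoured.ColourConnected G φ)
    (hfactor : TwoEdgeColoured.HasEulerianFactor G φ) :
    TwoEdgeColoured.Supereulerian G φ := by
  obtain ⟨π, hG⟩ := hext.exists_extendsMClosed hclosed
  obtain ⟨𝒜, h, hmin⟩ := (measure Finset.card).wf.has_min
    {𝒜 | TwoEdgeColoured.IsTourFactor G φ 𝒜} hfactor.exists_isTourFactor
  have hmin' : ∀ ℬ, TwoEdgeColoured.IsTourFactor G φ ℬ → 𝒜.card ≤ ℬ.card :=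
    fun ℬ hℬ => not_lt.1 (hmin ℬ hℬ)
  obtain ⟨hnt, ρ, hρ, -⟩ := hext
  -- Excludes the empty factor, so that the minimal one has a member.
  obtain ⟨v, hv⟩ : (G.vertexSet).Nonempty := by
    rw [← Set.image_nonempty, hρ]
    exact hnt.nonempty
  obtain ⟨S, hS, hvS⟩ := (h.cover v).1 hv
  obtain ⟨E, hE⟩ := h.isTour S hS
  have hSV : S = G.vertexSet := by
    refine hE.subset.antisymm fun w hw => ?_
    obtain ⟨T, hT, hwT⟩ := (h.cover w).1 hw
    rwa [h.eq_of_minimal hG hconn hmin' hS hT]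
  subst hSV
  exact hE.supereulerian
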